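/- A (bivariate) copula is a function $C\colon[0,1]^2\to[0,1]$ with $C(u,0)=0=C(0,v)$, $C(u,1)=u$, $C(1,v)=v$ and $C(u,v)-C(u,y)-C(x,v)+C(x,y)\ge 0$ whenever $x\le u$, $y\le v$. Let $\mathfrak C$ be the set of copulas and $\operatorname{span}\mathfrak C$ its real linear span in the space of functions $[0,1]^2\to\mathbb R$. For $A,B\in\operatorname{span}\mathfrak C$ put $$(A*B)(x,y)=\int_0^1\partial_2A(x,t)\,\partial_1B(t,y)\,dt,\qquad \|A\|=\Bigl(\int_0^1\!\!\int_0^1\bigl((\partial_1A)^2+(\partial_2A)^2\bigr)\,dx\,dy\Bigr)^{1/2}$$ (the partial derivatives exist almost everywhere). A copula $U$ is invertible if there is a copula $D$ with $U*D=D*U=M$, where $M(x,y)=\min(x,y)$; let $\operatorname{Inv}\mathfrak C$ be the set of invertible copulas, and for $A\in\operatorname{span}\mathfrak C$ put $\|A\|_*=\sup_{U,V\in\operatorname{Inv}\mathfrak C}\|U*A*V\|$. For $U,V\in\operatorname{Inv}\mathfrak C$ the shuffling map $S_{U,V}$ is $S_{U,V}(A)=U*A*V$. Theorem. A copula $U$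 is invertible if and only if $\|U\|=1$. For every $A\in\operatorname{span}\mathfrak C$ the supremum defining $\|A\|_*$ is taken over a nonempty set and is finite. If $A\in\operatorname{span}\mathfrak C$ and $U\in\operatorname{Inv}\mathfrak C$, then $U*A,\ A*U\in\operatorname{span}\mathfrak C$ and $$\|U*A\|_*=\|A\|_*=\|A*U\|_*.$$ Consequently, for all $U,V\in\operatorname{Inv}\mathfrak C$ the shuffling map $S_{U,V}$ maps $\operatorname{span}\mathfrak C$ into itself and is an isometry for the $*$-norm: $\|S_{U,V}(A)-S_{U,V}(B)\|_*=\|A-B\|_*$ for all $A,B\in\operatorname{span}\mathfrak C$. -/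

import Mathlib

noncomputable section

namespace Copula

/-- A bivariate copula: a function on the unit square with values in `[0,1]`, with the boundary
conditions of a joint distribution function with uniform margins, and 2-increasing. -/
structure IsCopula (C : unitInterval → unitInterval → ℝ) : Prop where
  mem_Icc : ∀ u v, C u v ∈ Set.Icc (0 : ℝ) 1
  right_zero : ∀ u, C u 0 = 0
  left_zero : ∀ v, C 0 v = 0
  right_one : ∀ u, C u 1 = u
  left_one : ∀ v, C 1 v = v
  two_increasing : ∀ x u y v, x ≤ u → y ≤ v → 0 ≤ C u v - C u y - C x v + C x y

/-- The linear span of the set of copulas, inside the real functions on the unit square. -/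
def spanCopulas : Submodule ℝ (unitInterval → unitInterval → ℝ) :=
  Submodule.span ℝ {C | IsCopula C}

/-- The extension of a function on the unit square to the plane that is constant outside of the
square in each variable; it only serves to differentiate. -/
def extend (C : unitInterval → unitInterval → ℝ) (x y : ℝ) : ℝ :=
  C (Set.projIcc 0 1 zero_le_one x) (Set.projIcc 0 1 zero_le_one y)

/-- The partial derivative in the first variable. At `x ∈ (0,1)` and `y ∈ [0,1]` this is the
derivative of `C(·, y)` at `x`; the values for other `x` are irrelevant below. -/
def partial₁ (C : unitInterval → unitInterval → ℝ) (x y : ℝ) : ℝ :=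
  deriv (fun s : ℝ => extend C s y) x

/-- The partial derivative in the second variable. -/
def partial₂ (C : unitInterval → unitInterval → ℝ) (x y : ℝ) : ℝ :=
  deriv (fun t : ℝ => extend C x t) y

/-- The product `(C * D)(x,y) = ∫₀¹ ∂₂C(x,t) ∂₁D(t,y) dt`. -/
def star (C D : unitInterval → unitInterval → ℝ) : unitInterval → unitInterval → ℝ :=
  fun x y => ∫ t in (0 : ℝ)..1, partial₂ C x t * partial₁ D t y

/-- The Sobolev norm `‖C‖ = (∫₀¹ ∫₀¹ (∂₁C)² + (∂₂C)² dx dy)^{1/2}`. -/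
def sobolevNorm (C : unitInterval → unitInterval → ℝ) : ℝ :=
  Real.sqrt (∫ y in (0 : ℝ)..1, ∫ x in (0 : ℝ)..1, (partial₁ C x y ^ 2 + partial₂ C x y ^ 2))

/-- The copula `M(x,y) = min(x,y)`, the identity of the product. -/
def minCopula : unitInterval → unitInterval → ℝ := fun x y => min (x : ℝ) (y : ℝ)

/-- The set of copulas that are invertible with respect to the product. -/
def invCopulas : Set (unitInterval → unitInterval → ℝ) :=
  {U | IsCopula U ∧ ∃ D, IsCopula D ∧ star U D = minCopula ∧ star D U = minCopula}

/-- The shuffling map `S_{U,V}(A) = U * A * V`. -/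
def shuffle (U V A : unitInterval → unitInterval → ℝ) : unitInterval → unitInterval → ℝ :=
  star (star U A) V

/-- The set of all values `‖U * A * V‖` with `U`, `V` invertible copulas. -/
def shuffleNorms (A : unitInterval → unitInterval → ℝ) : Set ℝ :=
  {r | ∃ U ∈ invCopulas, ∃ V ∈ invCopulas, r = sobolevNorm (shuffle U V A)}

/-- The `*`-norm `‖A‖_* = sup ‖U * A * V‖` over all invertible copulas `U`, `V`. -/
def starNorm (A : unitInterval → unitInterval → ℝ) : ℝ := sSup (shuffleNorms A)

end Copula

end

noncomputable section

open MeasureTheory Set Filter Topology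
open scoped NNReal

namespace Copula

variable {A B C D U V : unitInterval → unitInterval → ℝ} {K : ℝ≥0}

/-! ### Bounded measurable functions on the unit interval -/

/-! The product is bilinear on the span, sends pairs of copulas to copulas, is associative and has
unit $M$. Hence the invertible copulas are closed under products and inverses, so replacing $A$ by
$U*A$ or $A*U$ merely reindexes the values whose supremum is $\|A\|_*$. The supremum is finite
because every shuffle of a copula is a copula, hence 1-Lipschitz in each variable, which bounds the
Lipschitz constants of all shuffles of a fixed linear combination at once.

The analytic core is associativity. Put $T_Bh=\frac{d}{ds}\int_0^1\partial_2B(s,t)h(t)\,dt$. Since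
$\partial_1(B*C)(\cdot,y)=T_B\,\partial_1C(\cdot,y)$ and
$\partial_2(A*B)(x,\cdot)=T_{B^T}\partial_2A(x,\cdot)$, associativity says that $T_B$ and $T_{B^T}$
are adjoint (`integral_deriv_action_swap`).

The norm criterion rests on $\|U\|^2=\int(U^T*U)(y,y)\,dy+\int(U*U^T)(x,x)\,dx$
(`IsCopula.integral_sobolev`). The diagonal of a copula lies below the identity, and only $M$
attains it everywhere. Thus each term is at most $1/2$, and $\|U\|=1$ forces $U^T$ to be a two-sided
inverse. Conversely, `IsCopula.diag_of_star_eq` shows that any inverse forces both diagonals to be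
maximal. -/

lemma intervalIntegrable_of_abs_le {f : ℝ → ℝ} (hf : Measurable f) {c : ℝ} (h : ∀ t, |f t| ≤ c)
    (a b : ℝ) : IntervalIntegrable f volume a b :=
  (intervalIntegrable_const (c := c)).mono_fun hf.aestronglyMeasurable
    (ae_of_all _ fun t => by
      simpa only [Real.norm_eq_abs] using (h t).trans (le_abs_self c))

lemma abs_integral_le {f : ℝ → ℝ} {c : ℝ} (h : ∀ t, |f t| ≤ c) :
    |∫ t in (0 : ℝ)..1, f t| ≤ c := by
  simpa using intervalIntegral.norm_integral_le_of_norm_le_const (a := 0) (b := 1) (f := f)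
    fun t _ => h t

lemma abs_mul_le_mul {a b c d : ℝ} (ha : |a| ≤ c) (hb : |b| ≤ d) : |a * b| ≤ c * d := by
  rw [abs_mul]
  exact mul_le_mul ha hb (abs_nonneg _) ((abs_nonneg _).trans ha)

lemma integral_deriv_of_lipschitzWith {f : ℝ → ℝ} (hf : LipschitzWith K f) (a b : ℝ) :
    ∫ t in a..b, deriv f t = f b - f a :=
  hf.lipschitzOnWith.absolutelyContinuousOnInterval.integral_deriv_eq_sub

lemma integral_deriv_mul_of_lipschitzWith {f g : ℝ → ℝ} {L : ℝ≥0} (hf : LipschitzWith K f)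
    (hg : LipschitzWith L g) (a b : ℝ) :
    ∫ t in a..b, deriv f t * g t = f b * g b - f a * g a - ∫ t in a..b, f t * deriv g t := by
  rw [hf.lipschitzOnWith.absolutelyContinuousOnInterval.integral_mul_deriv_eq_deriv_mul
    hg.lipschitzOnWith.absolutelyContinuousOnInterval]
  ring

lemma abs_deriv_le_of_lipschitzWith {f : ℝ → ℝ} (hf : LipschitzWith K f) (t : ℝ) :
    |deriv f t| ≤ K := by
  simpa only [Real.norm_eq_abs] using norm_deriv_le_of_lipschitz hf

/-! ### The extension to the plane and its partial derivatives -/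

/-- The clamping of a real number to the unit interval. -/
abbrev clamp (x : ℝ) : unitInterval := projIcc (0 : ℝ) 1 zero_le_one x

lemma clamp_coe (x : unitInterval) : clamp (x : ℝ) = x := projIcc_val _ x

lemma clamp_of_mem {x : ℝ} (hx : x ∈ Icc (0 : ℝ) 1) : (clamp x : ℝ) = x := by
  rw [clamp, projIcc_of_mem _ hx]

lemma clamp_one : clamp 1 = 1 := clamp_coe 1

lemma monotone_clamp : Monotone clamp := monotone_projIcc _

lemma abs_clamp_sub_clamp_le (x y : ℝ) : |(clamp x : ℝ) - clamp y| ≤ |x - y| := by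
  simpa [Subtype.dist_eq, Real.dist_eq] using
    (LipschitzWith.projIcc (zero_le_one (α := ℝ))).dist_le_mul x y

lemma deriv_clamp {x : ℝ} (hx : x ∈ Ioo (0 : ℝ) 1) : deriv (fun t => (clamp t : ℝ)) x = 1 := by
  have : (fun t => (clamp t : ℝ)) =ᶠ[𝓝 x] id := by
    filter_upwards [Icc_mem_nhds hx.1 hx.2] with t ht using clamp_of_mem ht
  rw [this.deriv_eq, deriv_id]

lemma extend_coe (x y : unitInterval) : extend C x y = C x y := by
  simp [extend]

lemma extend_clamp_left (x y : ℝ) : extend C (clamp x) y = extend C x y := by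
  simp [extend]

lemma extend_clamp_right (x y : ℝ) : extend C x (clamp y) = extend C x y := by
  simp [extend]

lemma partial₁_clamp (x y : ℝ) : partial₁ C x (clamp y) = partial₁ C x y := by
  simp only [partial₁, extend_clamp_right]

lemma partial₂_clamp (x y : ℝ) : partial₂ C (clamp x) y = partial₂ C x y := by
  simp only [partial₂, extend_clamp_left]

/-- The function `C` is `K`-Lipschitz in each variable. -/
structure SepLipschitz (K : ℝ≥0) (C : unitInterval → unitInterval → ℝ) : Prop where
  left : ∀ y : ℝ, LipschitzWith K fun s => extend C s y
  right : ∀ x : ℝ, LipschitzWith K fun t => extend C x t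

namespace SepLipschitz

lemma swap (h : SepLipschitz K C) : SepLipschitz K (Function.swap C) :=
  ⟨fun y => h.right y, fun x => h.left x⟩

lemma of_le (h₁ : ∀ x x' y, |C x y - C x' y| ≤ K * |(x : ℝ) - x'|)
    (h₂ : ∀ x y y', |C x y - C x y'| ≤ K * |(y : ℝ) - y'|) : SepLipschitz K C := by
  refine ⟨fun y => .of_dist_le_mul fun s t => ?_, fun y => .of_dist_le_mul fun s t => ?_⟩
  · exact (h₁ _ _ _).trans (mul_le_mul_of_nonneg_left (abs_clamp_sub_clamp_le s t) K.2)
  · exact (h₂ _ _ _).trans (mul_le_mul_of_nonneg_left (abs_clamp_sub_clamp_le s t) K.2)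

lemma add {L : ℝ≥0} (h : SepLipschitz K C) (h' : SepLipschitz L D) :
    SepLipschitz (K + L) (C + D) :=
  ⟨fun y => (h.left y).add (h'.left y), fun x => (h.right x).add (h'.right x)⟩

lemma smul (h : SepLipschitz K C) (a : ℝ) : SepLipschitz (‖a‖₊ * K) (a • C) :=
  ⟨fun y => (lipschitzWith_smul a).comp (h.left y),
    fun x => (lipschitzWith_smul a).comp (h.right x)⟩

lemma zero : SepLipschitz 0 0 :=
  ⟨fun _ => LipschitzWith.const 0, fun _ => LipschitzWith.const 0⟩

lemma continuous (h : SepLipschitz K C) : Continuous (Function.uncurry (extend C)) :=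
  continuous_prod_of_continuous_lipschitzWith _ K (fun x => (h.right x).continuous) h.left

lemma abs_partial₁_le (h : SepLipschitz K C) (x y : ℝ) : |partial₁ C x y| ≤ K :=
  abs_deriv_le_of_lipschitzWith (h.left y) x

lemma abs_partial₂_le (h : SepLipschitz K C) (x y : ℝ) : |partial₂ C x y| ≤ K :=
  abs_deriv_le_of_lipschitzWith (h.right x) y

lemma measurable_partial₂_uncurry (h : SepLipschitz K C) :
    Measurable fun p : ℝ × ℝ => partial₂ C p.1 p.2 :=
  measurable_deriv_with_param h.continuous

lemma measurable_partial₁_uncurry (h : SepLipschitz K C) :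
    Measurable fun p : ℝ × ℝ => partial₁ C p.1 p.2 :=
  h.swap.measurable_partial₂_uncurry.comp measurable_swap

lemma ae_differentiableAt_left (h : SepLipschitz K C) (y : ℝ) :
    ∀ᵐ x : ℝ, DifferentiableAt ℝ (fun s => extend C s y) x :=
  (h.left y).ae_differentiableAt_real

/-- Fubini for the measurable set of points of differentiability. This order of quantifiers is the
one needed to differentiate under an integral over `y`. -/
lemma ae_ae_differentiableAt_left (h : SepLipschitz K C) :
    ∀ᵐ x : ℝ, ∀ᵐ y : ℝ, DifferentiableAt ℝ (fun s => extend C s y) x := by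
  have := measurableSet_of_differentiableAt_with_param ℝ h.swap.continuous
  exact (Measure.ae_ae_comm (p := fun y x : ℝ => DifferentiableAt ℝ (fun s => extend C s y) x)
    this).1 (ae_of_all _ h.ae_differentiableAt_left)

lemma integral_partial₁ (h : SepLipschitz K C) (a b y : ℝ) :
    ∫ t in a..b, partial₁ C t y = extend C b y - extend C a y :=
  integral_deriv_of_lipschitzWith (h.left y) a b

lemma integral_partial₂ (h : SepLipschitz K C) (x a b : ℝ) :
    ∫ t in a..b, partial₂ C x t = extend C x b - extend C x a :=
  h.swap.integral_partial₁ a b x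

end SepLipschitz

lemma measurable_partial₁ (y : ℝ) : Measurable fun t => partial₁ C t y := measurable_deriv _

lemma measurable_partial₂ (x : ℝ) : Measurable fun t => partial₂ C x t := measurable_deriv _

/-! ### Copulas -/

namespace IsCopula

lemma swap (h : IsCopula C) : IsCopula (Function.swap C) where
  mem_Icc u v := h.mem_Icc v u
  right_zero := h.left_zero
  left_zero := h.right_zero
  right_one := h.left_one
  left_one := h.right_one
  two_increasing x u y v hx hy := by
    have := h.two_increasing y v x u hy hx
    simp only [Function.swap]
    linarith

lemma of_two_increasing (h₁ : ∀ u, C u 0 = 0) (h₂ : ∀ v, C 0 v = 0)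
    (h₃ : ∀ u : unitInterval, C u 1 = u) (h₄ : ∀ v : unitInterval, C 1 v = v)
    (h : ∀ x u y v, x ≤ u → y ≤ v → 0 ≤ C u v - C u y - C x v + C x y) : IsCopula C := by
  refine ⟨fun u v => ⟨?_, ?_⟩, h₁, h₂, h₃, h₄, h⟩
  · simpa [h₁, h₂] using h 0 u 0 v u.2.1 v.2.1
  -- The rectangle $[0,u]\times[v,1]$ has mass $u-C(u,v)$.
  · have h0 := h 0 u v 1 u.2.1 v.2.2
    simp only [h₂, h₃] at h0
    linarith [u.2.2]

lemma mono_left (h : IsCopula C) (y : unitInterval) : Monotone fun x => C x y := by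
  intro x u hx
  have := h.two_increasing x u 0 y hx y.2.1
  simp only [h.right_zero] at this
  linarith

lemma abs_sub_le (h : IsCopula C) (x x' y : unitInterval) :
    |C x y - C x' y| ≤ |(x : ℝ) - x'| := by
  wlog hx : x' ≤ x generalizing x x'
  · rw [abs_sub_comm, abs_sub_comm (x : ℝ)]
    exact this x' x (le_of_not_ge hx)
  -- Nonnegative mass of $[x',x]\times[y,1]$ bounds the increment at height $y$ by that at height 1,
  -- which is $x-x'$.
  have h1 := h.two_increasing x' x y 1 hx y.2.2
  have h2 := h.mono_left y hx
  simp only [h.right_one] at h1 h2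
  have hx' : (x' : ℝ) ≤ x := hx
  rw [abs_of_nonneg (by linarith), abs_of_nonneg (sub_nonneg.2 hx')]
  linarith

lemma sepLipschitz (h : IsCopula C) : SepLipschitz 1 C :=
  .of_le (fun x x' y => by simpa using h.abs_sub_le x x' y)
    (fun x y y' => by simpa using h.swap.abs_sub_le y y' x)

lemma partial₁_nonneg (h : IsCopula C) (x y : ℝ) : 0 ≤ partial₁ C x y :=
  Monotone.deriv_nonneg fun _ _ hs => h.mono_left _ (monotone_clamp hs)

lemma partial₂_nonneg (h : IsCopula C) (x y : ℝ) : 0 ≤ partial₂ C x y :=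
  h.swap.partial₁_nonneg y x

lemma partial₁_le_one (h : IsCopula C) (x y : ℝ) : partial₁ C x y ≤ 1 :=
  (le_abs_self _).trans (h.sepLipschitz.abs_partial₁_le x y)

lemma partial₂_le_one (h : IsCopula C) (x y : ℝ) : partial₂ C x y ≤ 1 :=
  h.swap.partial₁_le_one y x

lemma abs_partial₁_le (h : IsCopula C) (x y : ℝ) : |partial₁ C x y| ≤ 1 :=
  h.sepLipschitz.abs_partial₁_le x y

lemma abs_partial₂_le (h : IsCopula C) (x y : ℝ) : |partial₂ C x y| ≤ 1 :=
  h.sepLipschitz.abs_partial₂_le x y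

/-- By 2-increasingness $C(\cdot,v)-C(\cdot,y)$ is monotone; its derivative splits wherever both
sections are differentiable. -/
lemma ae_partial₁_le (h : IsCopula C) {y v : ℝ} (hy : y ≤ v) :
    ∀ᵐ t : ℝ, partial₁ C t y ≤ partial₁ C t v := by
  filter_upwards [h.sepLipschitz.ae_differentiableAt_left y,
    h.sepLipschitz.ae_differentiableAt_left v] with t h1 h2
  have h3 : 0 ≤ deriv (fun s => extend C s v - extend C s y) t :=
    Monotone.deriv_nonneg fun s u hs => by
      have := h.two_increasing (clamp s) (clamp u) (clamp y) (clamp v)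
        (monotone_clamp hs) (monotone_clamp hy)
      simp only [extend]
      linarith
  rw [deriv_fun_sub h2 h1] at h3
  exact sub_nonneg.1 h3

lemma ae_partial₂_le (h : IsCopula C) {x u : ℝ} (hx : x ≤ u) :
    ∀ᵐ t : ℝ, partial₂ C x t ≤ partial₂ C u t :=
  h.swap.ae_partial₁_le hx

lemma partial₁_one (h : IsCopula C) {t : ℝ} (ht : t ∈ Ioo (0 : ℝ) 1) : partial₁ C t 1 = 1 := by
  refine Eq.trans ?_ (deriv_clamp ht)
  simp only [partial₁, extend, clamp_one, h.right_one]

lemma partial₂_one (h : IsCopula C) {t : ℝ} (ht : t ∈ Ioo (0 : ℝ) 1) : partial₂ C 1 t = 1 :=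
  h.swap.partial₁_one ht

lemma partial₁_zero (h : IsCopula C) (t : ℝ) : partial₁ C t 0 = 0 := by
  simp [partial₁, extend, h.right_zero]

lemma partial₂_zero (h : IsCopula C) (t : ℝ) : partial₂ C 0 t = 0 :=
  h.swap.partial₁_zero t

lemma extend_zero_left (h : IsCopula C) (y : ℝ) : extend C 0 y = 0 := by
  simp [extend, h.left_zero]

lemma extend_zero_right (h : IsCopula C) (x : ℝ) : extend C x 0 = 0 :=
  h.swap.extend_zero_left x

lemma extend_one_left (h : IsCopula C) (y : ℝ) : extend C 1 y = clamp y := by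
  simp [extend, h.left_one]

lemma extend_one_right (h : IsCopula C) (x : ℝ) : extend C x 1 = clamp x :=
  h.swap.extend_one_left x

end IsCopula

lemma integral_congr_Ioo {f g : ℝ → ℝ} (h : ∀ t ∈ Ioo (0 : ℝ) 1, f t = g t) :
    ∫ t in (0 : ℝ)..1, f t = ∫ t in (0 : ℝ)..1, g t := by
  rw [intervalIntegral.integral_of_le zero_le_one, intervalIntegral.integral_of_le zero_le_one,
    integral_Ioc_eq_integral_Ioo, integral_Ioc_eq_integral_Ioo]
  exact setIntegral_congr_fun measurableSet_Ioo h

/-! ### Elements of the span -/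

lemma exists_sepLipschitz (h : A ∈ spanCopulas) : ∃ K, SepLipschitz K A := by
  induction h using Submodule.span_induction with
  | mem C hC => exact ⟨1, hC.sepLipschitz⟩
  | zero => exact ⟨0, .zero⟩
  | add C D _ _ hC hD =>
    obtain ⟨K, hK⟩ := hC
    obtain ⟨L, hL⟩ := hD
    exact ⟨_, hK.add hL⟩
  | smul a C _ hC =>
    obtain ⟨K, hK⟩ := hC
    exact ⟨_, hK.smul a⟩

lemma IsCopula.mem_span (h : IsCopula C) : C ∈ spanCopulas := Submodule.subset_span h

lemma extend_zero_left_of_mem_span (h : A ∈ spanCopulas) (y : ℝ) : extend A 0 y = 0 := by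
  induction h using Submodule.span_induction with
  | mem C hC => exact hC.extend_zero_left y
  | zero => rfl
  | add C D _ _ hC hD =>
    rw [show extend (C + D) 0 y = extend C 0 y + extend D 0 y from rfl, hC, hD, add_zero]
  | smul a C _ hC => rw [show extend (a • C) 0 y = a * extend C 0 y from rfl, hC, mul_zero]

lemma swap_mem_span (h : A ∈ spanCopulas) : Function.swap A ∈ spanCopulas := by
  induction h using Submodule.span_induction with
  | mem C hC => exact hC.swap.mem_span
  | zero => exact zero_mem _
  | add C D _ _ hC hD => exact add_mem hC hD
  | smul a C _ hC => exact Submodule.smul_mem _ a hC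

/-! ### Algebra of the product -/

/-- Transposition reverses products, so one-sided statements need a proof on one side only. -/
lemma swap_star : Function.swap (star A B) = star (Function.swap B) (Function.swap A) := by
  ext x y
  exact intervalIntegral.integral_congr fun t _ => mul_comm _ _

lemma ae_partial₁_add {K L : ℝ≥0} (hA : SepLipschitz K A) (hB : SepLipschitz L B) (y : ℝ) :
    ∀ᵐ t : ℝ, partial₁ (A + B) t y = partial₁ A t y + partial₁ B t y := by
  filter_upwards [hA.ae_differentiableAt_left y, hB.ae_differentiableAt_left y] with t h1 h2
  exact deriv_fun_add h1 h2

lemma partial₁_smul (a : ℝ) (x y : ℝ) : partial₁ (a • A) x y = a * partial₁ A x y :=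
  deriv_const_mul_field a (v := fun s => extend A s y)

lemma SepLipschitz.intervalIntegrable_star {L : ℝ≥0} (hA : SepLipschitz K A)
    (hB : SepLipschitz L B) (x y a b : ℝ) :
    IntervalIntegrable (fun t => partial₂ A x t * partial₁ B t y) volume a b :=
  intervalIntegrable_of_abs_le ((measurable_partial₂ x).mul (measurable_partial₁ y))
    (fun t => abs_mul_le_mul (hA.abs_partial₂_le x t) (hB.abs_partial₁_le t y)) a b

lemma star_add (hA : A ∈ spanCopulas) (hB : B ∈ spanCopulas) (hC : C ∈ spanCopulas) :
    star A (B + C) = star A B + star A C := by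
  obtain ⟨K, hK⟩ := exists_sepLipschitz hA
  obtain ⟨L, hL⟩ := exists_sepLipschitz hB
  obtain ⟨M, hM⟩ := exists_sepLipschitz hC
  ext x y
  change star A (B + C) x y = star A B x y + star A C x y
  simp only [star]
  rw [← intervalIntegral.integral_add (hK.intervalIntegrable_star hL _ _ _ _)
    (hK.intervalIntegrable_star hM _ _ _ _)]
  refine intervalIntegral.integral_congr_ae ?_
  filter_upwards [ae_partial₁_add hL hM y] with t ht _
  rw [ht, mul_add]

lemma star_smul (a : ℝ) : star A (a • B) = a • star A B := by
  ext x y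
  change star A (a • B) x y = a * star A B x y
  simp only [star]
  rw [← intervalIntegral.integral_const_mul]
  refine intervalIntegral.integral_congr fun t _ => ?_
  simp only [partial₁_smul]
  ring

lemma star_zero : star A 0 = 0 := by simpa using star_smul (A := A) (B := 0) 0

lemma add_star (hA : A ∈ spanCopulas) (hB : B ∈ spanCopulas) (hC : C ∈ spanCopulas) :
    star (A + B) C = star A C + star B C := by
  have h := congrArg Function.swap
    (star_add (swap_mem_span hC) (swap_mem_span hA) (swap_mem_span hB))
  rw [swap_star] at h
  rw [show A + B = Function.swap (Function.swap A + Function.swap B) from rfl,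
    show C = Function.swap (Function.swap C) from rfl, h,
    show Function.swap (star (Function.swap C) (Function.swap A) +
      star (Function.swap C) (Function.swap B)) = Function.swap (star (Function.swap C)
      (Function.swap A)) + Function.swap (star (Function.swap C) (Function.swap B)) from rfl,
    swap_star, swap_star]

lemma smul_star (a : ℝ) : star (a • A) B = a • star A B := by
  have h := congrArg Function.swap (star_smul (A := Function.swap B) (B := Function.swap A) a)
  rw [swap_star] at h
  refine h.trans ?_
  rw [show Function.swap (a • star (Function.swap B) (Function.swap A)) =
    a • Function.swap (star (Function.swap B) (Function.swap A)) from rfl, swap_star]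

lemma zero_star : star 0 B = 0 := by simpa using smul_star (A := 0) (B := B) 0

lemma isCopula_star (hA : IsCopula A) (hB : IsCopula B) : IsCopula (star A B) := by
  have h1 : ∀ {A B}, IsCopula A → IsCopula B → ∀ u, star A B u 0 = 0 := fun {A B} _ hB u => by
    simp [star, hB.partial₁_zero]
  have h2 : ∀ {A B}, IsCopula A → IsCopula B → ∀ u, star A B u 1 = u := fun {A B} hA hB u => by
    have : star A B u 1 = ∫ t in (0 : ℝ)..1, partial₂ A u t :=
      integral_congr_Ioo fun t ht => by
        simp [hB.partial₁_one ht]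
    rw [this, hA.sepLipschitz.integral_partial₂, hA.extend_zero_right, hA.extend_one_right,
      clamp_coe, sub_zero]
  refine .of_two_increasing (h1 hA hB) (fun v => ?_) (h2 hA hB) (fun v => ?_)
    fun x u y v hx hy => ?_
  · have := h1 hB.swap hA.swap v
    rwa [← swap_star] at this
  · have := h2 hB.swap hA.swap v
    rwa [← swap_star] at this
  -- The mass of a rectangle under $A*B$ is
  -- $\int(\partial_2A(u,t)-\partial_2A(x,t))(\partial_1B(t,v)-\partial_1B(t,y))\,dt$, with both
  -- factors nonnegative almost everywhere.
  · have hi := fun x y : ℝ => hA.sepLipschitz.intervalIntegrable_star hB.sepLipschitz x y 0 1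
    simp only [star]
    rw [← intervalIntegral.integral_sub (hi _ _) (hi _ _), ← intervalIntegral.integral_sub
      ((hi _ _).sub (hi _ _)) (hi _ _), ← intervalIntegral.integral_add
      (((hi _ _).sub (hi _ _)).sub (hi _ _)) (hi _ _)]
    refine intervalIntegral.integral_nonneg_of_ae zero_le_one ?_
    filter_upwards [hA.ae_partial₂_le (x := x) (u := u) hx,
      hB.ae_partial₁_le (y := y) (v := v) hy] with t h3 h4
    simp only [Pi.zero_apply]
    nlinarith [mul_nonneg (sub_nonneg.2 h3) (sub_nonneg.2 h4)]

lemma star_mem_span (hA : A ∈ spanCopulas) (hB : B ∈ spanCopulas) : star A B ∈ spanCopulas := by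
  induction hA using Submodule.span_induction with
  | mem A hA =>
    induction hB using Submodule.span_induction with
    | mem B hB => exact (isCopula_star hA hB).mem_span
    | zero => rw [star_zero]; exact zero_mem _
    | add C D hC hD h1 h2 =>
      rw [star_add hA.mem_span hC hD]
      exact add_mem h1 h2
    | smul a C _ h =>
      rw [star_smul]
      exact Submodule.smul_mem _ a h
  | zero => rw [zero_star]; exact zero_mem _
  | add C D hC hD h1 h2 =>
    rw [add_star hC hD hB]
    exact add_mem h1 h2
  | smul a C _ h =>
    rw [smul_star]
    exact Submodule.smul_mem _ a h

/-! ### The identity of the product -/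

lemma isCopula_minCopula : IsCopula minCopula := by
  refine .of_two_increasing (fun u => min_eq_right u.2.1) (fun v => min_eq_left v.2.1)
    (fun u => min_eq_left u.2.2) (fun v => min_eq_right v.2.2) fun x u y v hx hy => ?_
  have hx' : (x : ℝ) ≤ u := hx
  have hy' : (y : ℝ) ≤ v := hy
  simp only [minCopula]
  grind

lemma swap_minCopula : Function.swap minCopula = minCopula := by
  ext x y
  exact min_comm _ _

lemma partial₂_minCopula_of_lt {x t : ℝ} (ht : 0 < t) (htx : t < x) (hx : x ≤ 1) :
    partial₂ minCopula x t = 1 := by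
  have : (fun s => extend minCopula x s) =ᶠ[𝓝 t] id := by
    filter_upwards [Icc_mem_nhds ht htx] with s hs
    simp only [extend, minCopula]
    rw [clamp_of_mem ⟨by linarith, hx⟩, clamp_of_mem ⟨hs.1, hs.2.trans hx⟩]
    exact min_eq_right hs.2
  rw [partial₂, this.deriv_eq, deriv_id]

lemma partial₂_minCopula_of_gt {x t : ℝ} (htx : x < t) : partial₂ minCopula x t = 0 := by
  have : (fun s => extend minCopula x s) =ᶠ[𝓝 t] fun _ => (clamp x : ℝ) := by
    filter_upwards [Ioi_mem_nhds htx] with s hs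
    exact min_eq_left (monotone_clamp (le_of_lt hs))
  rw [partial₂, this.deriv_eq, deriv_const]

/-- As $\partial_2M(x,\cdot)$ is the indicator of $[0,x)$ almost everywhere, the product integrates
$\partial_1A(\cdot,y)$ over $[0,x]$, and $A(0,y)=0$. -/
lemma minCopula_star (hA : A ∈ spanCopulas) : star minCopula A = A := by
  obtain ⟨K, hK⟩ := exists_sepLipschitz hA
  ext x y
  have hi := fun a b : ℝ =>
    isCopula_minCopula.sepLipschitz.intervalIntegrable_star hK (x : ℝ) (y : ℝ) a b
  have h1 : ∫ t in (0 : ℝ)..x, partial₂ minCopula x t * partial₁ A t y =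
      ∫ t in (0 : ℝ)..x, partial₁ A t y := by
    refine intervalIntegral.integral_congr_ae ?_
    filter_upwards [compl_mem_ae_iff.2 (measure_singleton (x : ℝ))] with t ht ht'
    rw [uIoc_of_le x.2.1] at ht'
    rw [partial₂_minCopula_of_lt ht'.1 (lt_of_le_of_ne ht'.2 ht) x.2.2, one_mul]
  have h2 : ∫ t in (x : ℝ)..1, partial₂ minCopula x t * partial₁ A t y = 0 := by
    refine intervalIntegral.integral_zero_ae (ae_of_all _ fun t ht => ?_)
    rw [uIoc_of_le x.2.2] at ht
    rw [partial₂_minCopula_of_gt ht.1, zero_mul]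
  rw [star, ← intervalIntegral.integral_add_adjacent_intervals (hi 0 x) (hi x 1), h1, h2,
    hK.integral_partial₁, extend_zero_left_of_mem_span hA, extend_coe]
  simp

lemma star_minCopula (hA : A ∈ spanCopulas) : star A minCopula = A := by
  have h := congrArg Function.swap (minCopula_star (swap_mem_span hA))
  rwa [swap_star, swap_minCopula] at h

/-! ### The Markov operator of a copula -/

/-- The action `s ↦ ∫₀¹ ∂₂B(s,t) h(t) dt` of `B` on functions. Its derivative is the image of `h`
under the Markov operator of `B`. -/
def action (B : unitInterval → unitInterval → ℝ) (h : ℝ → ℝ) (s : ℝ) : ℝ :=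
  ∫ t in (0 : ℝ)..1, partial₂ B s t * h t

lemma extend_star_left (s : ℝ) (y : ℝ) :
    extend (star A B) s y = action A (fun t => partial₁ B t y) s := by
  change star A B (clamp s) (clamp y) = _
  simp only [star, action, partial₁_clamp, partial₂_clamp]

lemma extend_star_right (x t : ℝ) :
    extend (star A B) x t = action (Function.swap B) (fun s => partial₂ A x s) t := by
  rw [show (fun s => partial₂ A x s) = fun s => partial₁ (Function.swap A) s x from rfl,
    ← extend_star_left, ← swap_star]
  rfl

section

variable {h k : ℝ → ℝ} {c : ℝ}

lemma IsCopula.intervalIntegrable_action (hB : IsCopula B) (hm : Measurable h)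
    (hc : ∀ t, |h t| ≤ c) (s a b : ℝ) :
    IntervalIntegrable (fun t => partial₂ B s t * h t) volume a b :=
  intervalIntegrable_of_abs_le ((measurable_partial₂ s).mul hm)
    (fun t => abs_mul_le_mul (hB.abs_partial₂_le s t) (hc t)) a b

lemma action_sub (hB : IsCopula B) (hm : Measurable h) (hc : ∀ t, |h t| ≤ c) {d : ℝ}
    (hm' : Measurable k) (hd : ∀ t, |k t| ≤ d) (s : ℝ) :
    action B (fun t => h t - k t) s = action B h s - action B k s := by
  simp only [action]
  rw [← intervalIntegral.integral_sub (hB.intervalIntegrable_action hm hc s _ _)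
    (hB.intervalIntegrable_action hm' hd s _ _)]
  simp only [mul_sub]

lemma action_const (hB : IsCopula B) (c : ℝ) (s : ℝ) :
    action B (fun _ => c) s = c * clamp s := by
  simp only [action]
  rw [intervalIntegral.integral_mul_const, hB.sepLipschitz.integral_partial₂,
    hB.extend_zero_right, hB.extend_one_right]
  ring

lemma action_zero (hB : IsCopula B) : action B h 0 = 0 := by
  simp [action, hB.partial₂_zero]

lemma action_one (hB : IsCopula B) : action B h 1 = ∫ t in (0 : ℝ)..1, h t :=
  integral_congr_Ioo fun t ht => by rw [hB.partial₂_one ht, one_mul]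

/-- The increments of the action are dominated when the functions are. -/
lemma action_sub_le_action_sub (hB : IsCopula B) (hm : Measurable h) (hc : ∀ t, |h t| ≤ c)
    {d : ℝ} (hm' : Measurable k) (hd : ∀ t, |k t| ≤ d) (hle : ∀ t, h t ≤ k t) {s s' : ℝ}
    (hs : s ≤ s') : action B h s' - action B h s ≤ action B k s' - action B k s := by
  simp only [action]
  have hi := fun s => hB.intervalIntegrable_action hm hc s 0 1
  have hi' := fun s => hB.intervalIntegrable_action hm' hd s 0 1
  rw [← intervalIntegral.integral_sub (hi _) (hi _), ← intervalIntegral.integral_sub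
    (hi' _) (hi' _)]
  refine intervalIntegral.integral_mono_ae zero_le_one ((hi _).sub (hi _))
    ((hi' _).sub (hi' _)) ?_
  filter_upwards [hB.ae_partial₂_le hs] with t ht
  nlinarith [mul_nonneg (sub_nonneg.2 ht) (sub_nonneg.2 (hle t))]

lemma action_neg (s : ℝ) : action B (fun t => -h t) s = -action B h s := by
  simp [action]

lemma abs_action_sub_le (hB : IsCopula B) (hm : Measurable h) (hc : ∀ t, |h t| ≤ c) {s s' : ℝ}
    (hs : s ≤ s') : |action B h s' - action B h s| ≤
      action B (fun t => |h t|) s' - action B (fun t => |h t|) s := by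
  have hc' : ∀ t, |(|h t|)| ≤ c := fun t => by rw [abs_abs]; exact hc t
  have h1 := action_sub_le_action_sub hB hm hc hm.abs hc' (fun t => le_abs_self _) hs
  have h2 := action_sub_le_action_sub (h := fun t => -h t) hB hm.neg
    (fun t => by rw [abs_neg]; exact hc t) hm.abs hc' (fun t => neg_le_abs _) hs
  simp only [action_neg] at h2
  exact abs_le.2 ⟨by linarith, h1⟩

lemma lipschitzWith_action (hB : IsCopula B) (hm : Measurable h) (hK : ∀ t, |h t| ≤ K) :
    LipschitzWith K (action B h) := by
  have key : ∀ s s', s ≤ s' → |action B h s' - action B h s| ≤ K * |s' - s| := by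
    intro s s' hs
    have h1 := action_sub_le_action_sub hB hm.abs (fun t => by rw [abs_abs]; exact hK t)
      (measurable_const (a := (K : ℝ))) (fun _ => le_rfl) hK hs
    rw [action_const hB, action_const hB, ← mul_sub] at h1
    exact (abs_action_sub_le hB hm hK hs).trans (h1.trans (mul_le_mul_of_nonneg_left
      ((le_abs_self _).trans (abs_clamp_sub_clamp_le s' s)) K.2))
  refine .of_dist_le_mul fun s s' => ?_
  rcases le_total s s' with hs | hs
  · rw [dist_comm, dist_comm s]
    exact key s s' hs
  · exact key s' s hs

/-- Positivity of the Markov operator: the actions of $|h|-h$ and $|h|+h$ are monotone. -/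
lemma abs_deriv_action_le (hB : IsCopula B) (hm : Measurable h) (hK : ∀ t, |h t| ≤ K) :
    ∀ᵐ s, |deriv (action B h) s| ≤ deriv (action B fun t => |h t|) s := by
  have hK' : ∀ t, |(|h t|)| ≤ K := fun t => by rw [abs_abs]; exact hK t
  filter_upwards [(lipschitzWith_action hB hm hK).ae_differentiableAt_real,
    (lipschitzWith_action hB hm.abs hK').ae_differentiableAt_real] with s h1 h2
  have h3 : 0 ≤ deriv (fun s => action B (fun t => |h t|) s - action B h s) s :=
    Monotone.deriv_nonneg fun s s' hs => by
      have := (abs_le.1 (abs_action_sub_le hB hm hK hs)).2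
      linarith
  have h4 : 0 ≤ deriv (fun s => action B (fun t => |h t|) s + action B h s) s :=
    Monotone.deriv_nonneg fun s s' hs => by
      have := (abs_le.1 (abs_action_sub_le hB hm hK hs)).1
      linarith
  rw [deriv_fun_sub h2 h1] at h3
  rw [deriv_fun_add h2 h1] at h4
  exact abs_le.2 ⟨by linarith, by linarith⟩

/-- Markov operators are contractions in mean. -/
lemma integral_abs_deriv_action_le (hB : IsCopula B) (hm : Measurable h)
    (hK : ∀ t, |h t| ≤ K) :
    ∫ s in (0 : ℝ)..1, |deriv (action B h) s| ≤ ∫ t in (0 : ℝ)..1, |h t| := by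
  have hK' : ∀ t, |(|h t|)| ≤ K := fun t => by rw [abs_abs]; exact hK t
  have hL := lipschitzWith_action hB hm hK
  have hL' := lipschitzWith_action hB hm.abs hK'
  calc _ ≤ ∫ s in (0 : ℝ)..1, deriv (action B fun t => |h t|) s :=
        intervalIntegral.integral_mono_ae zero_le_one
          (intervalIntegrable_of_abs_le (measurable_deriv _).abs
            (fun t => by rw [abs_abs]; exact abs_deriv_le_of_lipschitzWith hL t) _ _)
          (intervalIntegrable_of_abs_le (measurable_deriv _)
            (abs_deriv_le_of_lipschitzWith hL') _ _)
          (abs_deriv_action_le hB hm hK)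
    _ = _ := by
      rw [integral_deriv_of_lipschitzWith hL', action_one hB, action_zero hB, sub_zero]

end

/-! ### Adjointness of the actions of a copula and its transpose -/

section

variable {φ h : ℝ → ℝ} {c : ℝ} {L M : ℝ≥0}

/-- Integration by parts takes the derivative off $B$, leaving an integrand that is Lipschitz in $s$
and can be differentiated under the integral. -/
lemma action_eq_of_lipschitzWith (hB : IsCopula B) (hL : LipschitzWith L h) (s : ℝ) :
    action B h s = clamp s * h 1 - ∫ t in (0 : ℝ)..1, extend B s t * deriv h t := by
  rw [action]
  simp only [partial₂]
  rw [integral_deriv_mul_of_lipschitzWith (hB.sepLipschitz.right s) hL, hB.extend_zero_right,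
    hB.extend_one_right]
  ring

lemma ae_deriv_action (hB : IsCopula B) (hL : LipschitzWith L h) :
    ∀ᵐ s : ℝ, s ∈ Ioo (0 : ℝ) 1 →
      deriv (action B h) s = h 1 - ∫ t in (0 : ℝ)..1, partial₁ B s t * deriv h t := by
  filter_upwards [hB.sepLipschitz.ae_ae_differentiableAt_left] with s hs hs01
  have hmeas : ∀ x : ℝ, Measurable fun t => extend B x t * deriv h t := fun x =>
    (hB.sepLipschitz.right x).continuous.measurable.mul (measurable_deriv _)
  have hb : ∀ x t : ℝ, |extend B x t| ≤ 1 := fun x t => by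
    have := hB.mem_Icc (clamp x) (clamp t)
    exact abs_le.2 ⟨by linarith [this.1, show extend B x t = B (clamp x) (clamp t) from rfl],
      this.2⟩
  have h1 : HasDerivAt (fun x => ∫ t in (0 : ℝ)..1, extend B x t * deriv h t)
      (∫ t in (0 : ℝ)..1, partial₁ B s t * deriv h t) s := by
    refine (intervalIntegral.hasDerivAt_integral_of_dominated_loc_of_lip (s := univ)
      (bound := fun _ => (L : ℝ)) univ_mem (Eventually.of_forall fun x =>
        (hmeas x).aestronglyMeasurable) ?_ ?_ ?_ (by simp) ?_).2
    · exact intervalIntegrable_of_abs_le (hmeas s) (fun t => abs_mul_le_mul (hb s t)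
        (abs_deriv_le_of_lipschitzWith hL t)) 0 1
    · exact ((hB.sepLipschitz.measurable_partial₁_uncurry.comp measurable_prodMk_left).mul
        (measurable_deriv _)).aestronglyMeasurable
    · refine ae_of_all _ fun t _ => LipschitzWith.lipschitzOnWith (.of_dist_le_mul fun x x' => ?_)
      have h2 := (hB.sepLipschitz.left t).dist_le_mul x x'
      rw [Real.dist_eq] at h2 ⊢
      rw [← sub_mul, abs_mul, mul_comm]
      have h3 := abs_deriv_le_of_lipschitzWith hL t
      rw [Real.coe_nnabs, abs_of_nonneg (NNReal.coe_nonneg L)]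
      exact mul_le_mul h3 (by simpa using h2) (abs_nonneg _) L.2
    · filter_upwards [hs] with t ht _ using ht.hasDerivAt.mul_const _
  have h2 : HasDerivAt (fun t => (clamp t : ℝ) * h 1) (1 * h 1) s := by
    refine HasDerivAt.mul_const ((hasDerivAt_id s).congr_of_eventuallyEq ?_) _
    filter_upwards [Icc_mem_nhds hs01.1 hs01.2] with t ht using clamp_of_mem ht
  rw [funext (action_eq_of_lipschitzWith hB hL)]
  simpa using (h2.fun_sub h1).deriv

lemma integral_congr_ae_Ioo {f g : ℝ → ℝ} (h : ∀ᵐ t : ℝ, t ∈ Ioo (0 : ℝ) 1 → f t = g t) :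
    ∫ t in (0 : ℝ)..1, f t = ∫ t in (0 : ℝ)..1, g t := by
  rw [intervalIntegral.integral_of_le zero_le_one, intervalIntegral.integral_of_le zero_le_one,
    integral_Ioc_eq_integral_Ioo, integral_Ioc_eq_integral_Ioo]
  exact setIntegral_congr_ae measurableSet_Ioo h

/-- Both sides equal $h(1)\int\varphi-\iint\varphi(s)\,\partial_1B(s,t)\,h'(t)$: the right one by
`ae_deriv_action`, the left one by parts in $t$ and Fubini. -/
lemma integral_deriv_action_swap_of_lipschitzWith (hB : IsCopula B) (hφ : Measurable φ)
    (hK : ∀ t, |φ t| ≤ K) (hL : LipschitzWith L h) :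
    ∫ t in (0 : ℝ)..1, deriv (action (Function.swap B) φ) t * h t =
      ∫ s in (0 : ℝ)..1, φ s * deriv (action B h) s := by
  have hφi := intervalIntegrable_of_abs_le hφ hK 0 1
  have hbd : ∀ s t, |φ s * (partial₁ B s t * deriv h t)| ≤ K * (1 * L) := fun s t =>
    abs_mul_le_mul (hK s) (abs_mul_le_mul (hB.abs_partial₁_le s t)
      (abs_deriv_le_of_lipschitzWith hL t))
  have hmeas : Measurable (Function.uncurry fun s t : ℝ => φ s * (partial₁ B s t * deriv h t)) :=
    (hφ.comp measurable_fst).mul (hB.sepLipschitz.measurable_partial₁_uncurry.mul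
      ((measurable_deriv h).comp measurable_snd))
  have hint : Measurable fun s => ∫ t in (0 : ℝ)..1, φ s * (partial₁ B s t * deriv h t) := by
    simp only [intervalIntegral.integral_of_le zero_le_one]
    exact hmeas.stronglyMeasurable.integral_prod_right.measurable
  have hint' : IntervalIntegrable
      (fun s => ∫ t in (0 : ℝ)..1, φ s * (partial₁ B s t * deriv h t)) volume 0 1 := by
    exact intervalIntegrable_of_abs_le hint (fun s => abs_integral_le (hbd s)) _ _
  have h1 : ∫ s in (0 : ℝ)..1, φ s * deriv (action B h) s =
      (∫ s in (0 : ℝ)..1, φ s) * h 1 -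
        ∫ s in (0 : ℝ)..1, ∫ t in (0 : ℝ)..1, φ s * (partial₁ B s t * deriv h t) := by
    rw [← intervalIntegral.integral_mul_const, ← intervalIntegral.integral_sub
      (hφi.mul_const _) hint']
    refine integral_congr_ae_Ioo ?_
    filter_upwards [ae_deriv_action hB hL] with s hs hs01
    rw [hs hs01, intervalIntegral.integral_const_mul]
    ring
  rw [h1, integral_deriv_mul_of_lipschitzWith (lipschitzWith_action hB.swap hφ hK) hL,
    action_one hB.swap, action_zero hB.swap, intervalIntegral_intervalIntegral_swap]
  · rw [zero_mul, sub_zero]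
    congr 1
    refine intervalIntegral.integral_congr fun t _ => ?_
    simp only [action]
    rw [← intervalIntegral.integral_mul_const]
    refine intervalIntegral.integral_congr fun s _ => ?_
    change partial₁ B s t * φ s * deriv h t = φ s * (partial₁ B s t * deriv h t)
    ring
  · refine Measure.integrableOn_of_bounded (M := K * (1 * L)) ?_ hmeas.aestronglyMeasurable
      (ae_of_all _ fun p => hbd p.1 p.2)
    rw [Measure.volume_eq_prod, Measure.prod_prod]
    exact ENNReal.mul_ne_top (by simp) (by simp)

/-- The Markov operators of a copula and of its transpose are adjoint to each other. -/
lemma integral_deriv_action_swap (hB : IsCopula B) (hφ : Measurable φ)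
    (hM : ∀ t, |φ t| ≤ M) {H : ℝ → ℝ} (hH : LipschitzWith K H) :
    ∫ t in (0 : ℝ)..1, deriv (action (Function.swap B) φ) t * deriv H t =
      ∫ s in (0 : ℝ)..1, φ s * deriv (action B (deriv H)) s := by
  set δ : ℕ → ℝ := fun n => ((n : ℝ) + 1)⁻¹ with hδ
  have hδpos : ∀ n, 0 < δ n := fun n => by positivity
  have hδlim : Tendsto δ atTop (𝓝[≠] 0) := by
    refine tendsto_nhdsWithin_iff.2 ⟨?_, Eventually.of_forall fun n => (hδpos n).ne'⟩
    simpa [hδ, one_div] using tendsto_one_div_add_atTop_nhds_zero_nat (𝕜 := ℝ)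
  -- Difference quotients approximate `deriv H`. Each is Lipschitz, so the previous lemma applies;
  -- those constants need not be uniform in `n`, but the sup bound `K` is.
  set q : ℕ → ℝ → ℝ := fun n t => (δ n)⁻¹ * (H (t + δ n) - H t) with hq
  have hqK : ∀ n t, |q n t| ≤ K := fun n t => by
    have := hH.dist_le_mul (t + δ n) t
    rw [Real.dist_eq, Real.dist_eq, add_sub_cancel_left, abs_of_pos (hδpos n)] at this
    simp only [hq]
    rw [abs_mul, abs_of_pos (inv_pos.2 (hδpos n)), inv_mul_le_iff₀ (hδpos n)]
    linarith
  have hqL : ∀ n, ∃ L : ℝ≥0, LipschitzWith L (q n) := fun n =>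
    ⟨_, (lipschitzWith_smul (δ n)⁻¹).comp
      ((hH.comp (LipschitzWith.id.add (LipschitzWith.const (δ n)))).sub hH)⟩
  have hqm : ∀ n, Measurable (q n) := fun n => (hqL n).choose_spec.continuous.measurable
  have hdm : Measurable (deriv H) := measurable_deriv H
  have hdK : ∀ t, |deriv H t| ≤ K := abs_deriv_le_of_lipschitzWith hH
  have hqlim : ∀ᵐ t : ℝ, Tendsto (fun n => q n t) atTop (𝓝 (deriv H t)) := by
    filter_upwards [hH.ae_differentiableAt_real] with t ht
    have := (hasDerivAt_iff_tendsto_slope_zero.1 ht.hasDerivAt).comp hδlim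
    simpa [hq, Function.comp_def] using this
  have hGl := lipschitzWith_action hB.swap hφ hM
  have hl : Tendsto (fun n => ∫ t in (0 : ℝ)..1, deriv (action (Function.swap B) φ) t * q n t)
      atTop (𝓝 (∫ t in (0 : ℝ)..1, deriv (action (Function.swap B) φ) t * deriv H t)) := by
    refine intervalIntegral.tendsto_integral_filter_of_dominated_convergence
      (fun _ => (M : ℝ) * K) (Eventually.of_forall fun n =>
        ((measurable_deriv _).mul (hqm n)).aestronglyMeasurable)
      (Eventually.of_forall fun n => ae_of_all _ fun t _ =>
        abs_mul_le_mul (abs_deriv_le_of_lipschitzWith hGl t) (hqK n t)) (by simp) ?_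
    filter_upwards [hqlim] with t ht _ using ht.const_mul _
  -- On the right-hand side the Markov operator acts on `q n`, and pointwise convergence need not
  -- pass through it. Convergence in mean does, by `integral_abs_deriv_action_le`.
  have hd : Tendsto (fun n => ∫ t in (0 : ℝ)..1, |q n t - deriv H t|) atTop (𝓝 0) := by
    have : Tendsto (fun n => ∫ t in (0 : ℝ)..1, |q n t - deriv H t|) atTop
        (𝓝 (∫ t in (0 : ℝ)..1, (0 : ℝ))) := by
      refine intervalIntegral.tendsto_integral_filter_of_dominated_convergence
        (fun _ => (K : ℝ) + K) (Eventually.of_forall fun n =>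
          ((hqm n).sub hdm).abs.aestronglyMeasurable)
        (Eventually.of_forall fun n => ae_of_all _ fun t _ => ?_) (by simp) ?_
      · rw [Real.norm_eq_abs, abs_abs]
        exact (abs_sub _ _).trans (add_le_add (hqK n t) (hdK t))
      · filter_upwards [hqlim] with t ht _
        simpa using (ht.sub_const (deriv H t)).abs
    simpa using this
  have hFl : ∀ n, LipschitzWith K (action B (q n)) := fun n =>
    lipschitzWith_action hB (hqm n) (hqK n)
  have hFl' : LipschitzWith K (action B (deriv H)) := lipschitzWith_action hB hdm hdK
  have hint : ∀ {F : ℝ → ℝ}, LipschitzWith K F →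
      IntervalIntegrable (fun s => φ s * deriv F s) volume 0 1 := fun hF =>
    intervalIntegrable_of_abs_le (hφ.mul (measurable_deriv _))
      (fun t => abs_mul_le_mul (hM t) (abs_deriv_le_of_lipschitzWith hF t)) _ _
  have hr : Tendsto (fun n => ∫ s in (0 : ℝ)..1, φ s * deriv (action B (q n)) s) atTop
      (𝓝 (∫ s in (0 : ℝ)..1, φ s * deriv (action B (deriv H)) s)) := by
    refine tendsto_iff_norm_sub_tendsto_zero.2 (squeeze_zero (fun _ => norm_nonneg _)
      (fun n => ?_) (by simpa using hd.const_mul (M : ℝ)))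
    have hKK : ∀ t, |q n t - deriv H t| ≤ ((K + K : ℝ≥0) : ℝ) := fun t =>
      (abs_sub _ _).trans (add_le_add (hqK n t) (hdK t))
    have hml := lipschitzWith_action hB ((hqm n).sub hdm) hKK
    rw [← intervalIntegral.integral_sub (hint (hFl n)) (hint hFl')]
    calc _ ≤ ∫ s in (0 : ℝ)..1, ‖φ s * deriv (action B (q n)) s -
          φ s * deriv (action B (deriv H)) s‖ :=
        intervalIntegral.norm_integral_le_integral_norm zero_le_one
      _ ≤ ∫ s in (0 : ℝ)..1, M * |deriv (action B fun t => q n t - deriv H t) s| := by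
        refine intervalIntegral.integral_mono_ae zero_le_one
          ((hint (hFl n)).sub (hint hFl')).norm
          (IntervalIntegrable.const_mul (intervalIntegrable_of_abs_le (measurable_deriv _).abs
            (fun t => by rw [abs_abs]; exact abs_deriv_le_of_lipschitzWith hml t) _ _) _) ?_
        filter_upwards [(hFl n).ae_differentiableAt_real, hFl'.ae_differentiableAt_real]
          with s h1 h2
        rw [funext (action_sub hB (hqm n) (hqK n) hdm hdK), deriv_fun_sub h1 h2, ← mul_sub,
          norm_mul]
        exact mul_le_mul_of_nonneg_right (hM s) (norm_nonneg _)
      _ = M * ∫ s in (0 : ℝ)..1, |deriv (action B fun t => q n t - deriv H t) s| :=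
        intervalIntegral.integral_const_mul _ _
      _ ≤ _ := mul_le_mul_of_nonneg_left
        (integral_abs_deriv_action_le hB ((hqm n).sub hdm) hKK) M.2
  refine tendsto_nhds_unique hl (hr.congr fun n => ?_)
  obtain ⟨L, hL⟩ := hqL n
  exact (integral_deriv_action_swap_of_lipschitzWith hB hφ hM hL).symm

end

/-! ### Associativity -/

/-- Adjointness for $\varphi=\partial_2A(x,\cdot)$ and $H=C(\cdot,y)$. -/
lemma star_assoc_of_isCopula (hA : IsCopula A) (hB : IsCopula B) (hC : IsCopula C) :
    star (star A B) C = star A (star B C) := by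
  ext x y
  have h1 : ∀ t, partial₂ (star A B) x t =
      deriv (action (Function.swap B) fun s => partial₂ A x s) t := fun t => by
    rw [partial₂, funext (extend_star_right (A := A) (B := B) x)]
  have h2 : ∀ s, partial₁ (star B C) s y = deriv (action B fun t => partial₁ C t y) s :=
    fun s => by
      rw [partial₁, funext fun s => extend_star_left (A := B) (B := C) s y]
  rw [star, star]
  simp only [h1, h2]
  exact integral_deriv_action_swap (M := 1) hB (measurable_partial₂ _)
    (fun t => by simpa using hA.abs_partial₂_le x t) (hC.sepLipschitz.left y)

lemma star_assoc (hA : A ∈ spanCopulas) (hB : B ∈ spanCopulas) (hC : C ∈ spanCopulas) :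
    star (star A B) C = star A (star B C) := by
  induction hA using Submodule.span_induction with
  | mem A hA =>
    induction hB using Submodule.span_induction with
    | mem B hB =>
      induction hC using Submodule.span_induction with
      | mem C hC => exact star_assoc_of_isCopula hA hB hC
      | zero => simp only [star_zero]
      | add C D hC hD h1 h2 =>
        have hA := hA.mem_span
        have hB := hB.mem_span
        rw [star_add (star_mem_span hA hB) hC hD, star_add hB hC hD,
          star_add hA (star_mem_span hB hC) (star_mem_span hB hD), h1, h2]
      | smul a C _ h => rw [star_smul, star_smul, star_smul, h]
    | zero => simp only [star_zero, zero_star]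
    | add B D hB hD h1 h2 =>
      have hA := hA.mem_span
      rw [star_add hA hB hD, add_star (star_mem_span hA hB) (star_mem_span hA hD) hC,
        add_star hB hD hC, star_add hA (star_mem_span hB hC) (star_mem_span hD hC), h1, h2]
    | smul a B _ h => rw [star_smul, smul_star, smul_star, star_smul, h]
  | zero => simp only [zero_star]
  | add A D hA hD h1 h2 =>
    rw [add_star hA hD hB, add_star (star_mem_span hA hB) (star_mem_span hD hB) hC,
      add_star hA hD (star_mem_span hB hC), h1, h2]
  | smul a A _ h => rw [smul_star, smul_star, smul_star, h]

/-! ### The Sobolev norm -/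

lemma SepLipschitz.integrableOn_partial₁_sq (h : SepLipschitz K C) (s : Set (ℝ × ℝ))
    (hs : volume s ≠ ⊤) : IntegrableOn (fun p : ℝ × ℝ => partial₁ C p.1 p.2 ^ 2) s := by
  refine Measure.integrableOn_of_bounded (M := (K : ℝ) ^ 2) hs
    (h.measurable_partial₁_uncurry.pow_const 2).aestronglyMeasurable (ae_of_all _ fun p => ?_)
  rw [norm_pow]
  exact pow_le_pow_left₀ (norm_nonneg _) (h.abs_partial₁_le _ _) 2

lemma SepLipschitz.intervalIntegrable_partial₁_sq (h : SepLipschitz K C) (y : ℝ) :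
    IntervalIntegrable (fun x => partial₁ C x y ^ 2) volume 0 1 :=
  intervalIntegrable_of_abs_le ((measurable_partial₁ y).pow_const 2) (c := (K : ℝ) ^ 2)
    (fun x => by rw [abs_pow]; exact pow_le_pow_left₀ (abs_nonneg _) (h.abs_partial₁_le _ _) 2) _ _

lemma SepLipschitz.intervalIntegrable_partial₂_sq (h : SepLipschitz K C) (y : ℝ) :
    IntervalIntegrable (fun x => partial₂ C x y ^ 2) volume 0 1 :=
  intervalIntegrable_of_abs_le ((h.measurable_partial₂_uncurry.comp
    measurable_prodMk_right).pow_const 2) (c := (K : ℝ) ^ 2)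
    (fun x => by rw [abs_pow]; exact pow_le_pow_left₀ (abs_nonneg _) (h.abs_partial₂_le _ _) 2) _ _

/-- `∫₀¹ ∂₁C(t,y)² dt` is the diagonal of the product of `C` with its transpose. -/
lemma integral_partial₁_sq (C : unitInterval → unitInterval → ℝ) (y : ℝ) :
    ∫ t in (0 : ℝ)..1, partial₁ C t y ^ 2 = extend (star (Function.swap C) C) y y := by
  refine intervalIntegral.integral_congr fun t _ => ?_
  change partial₁ C t y ^ 2 = partial₁ C t (clamp y) * partial₁ C t (clamp y)
  rw [partial₁_clamp, sq]

lemma integral_partial₂_sq (C : unitInterval → unitInterval → ℝ) (x : ℝ) :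
    ∫ t in (0 : ℝ)..1, partial₂ C x t ^ 2 = extend (star C (Function.swap C)) x x :=
  integral_partial₁_sq (Function.swap C) x

lemma IsCopula.continuous_diag (h : IsCopula C) : Continuous fun x => extend C x x :=
  h.sepLipschitz.continuous.comp (continuous_id.prodMk continuous_id)

/-- The square of the Sobolev norm of a copula in terms of its products with its transpose. -/
lemma IsCopula.integral_sobolev (h : IsCopula C) :
    ∫ y in (0 : ℝ)..1, ∫ x in (0 : ℝ)..1, (partial₁ C x y ^ 2 + partial₂ C x y ^ 2) =
      (∫ y in (0 : ℝ)..1, extend (star (Function.swap C) C) y y) +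
        ∫ x in (0 : ℝ)..1, extend (star C (Function.swap C)) x x := by
  have hL := h.sepLipschitz
  -- The diagonal of $C*C^T$ integrates $(\partial_2C)^2$ over the second variable first, opposite
  -- to the order in the norm.
  have h1 : ∫ x in (0 : ℝ)..1, extend (star C (Function.swap C)) x x =
      ∫ y in (0 : ℝ)..1, ∫ x in (0 : ℝ)..1, partial₂ C x y ^ 2 := by
    simp only [← integral_partial₂_sq]
    refine intervalIntegral_intervalIntegral_swap ?_
    refine (hL.swap.integrableOn_partial₁_sq (uIoc 0 1 ×ˢ uIoc 0 1) ?_).swap.congr_fun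
      (fun _ _ => rfl) (measurableSet_uIoc.prod measurableSet_uIoc)
    rw [Measure.volume_eq_prod, Measure.prod_prod]
    exact ENNReal.mul_ne_top (by simp) (by simp)
  have h2 : ∀ y : ℝ, ∫ x in (0 : ℝ)..1, (partial₁ C x y ^ 2 + partial₂ C x y ^ 2) =
      extend (star (Function.swap C) C) y y + ∫ x in (0 : ℝ)..1, partial₂ C x y ^ 2 := fun y => by
    rw [← integral_partial₁_sq, intervalIntegral.integral_add
      (hL.intervalIntegrable_partial₁_sq y) (hL.intervalIntegrable_partial₂_sq y)]
  have hmeas : Measurable fun y => ∫ x in (0 : ℝ)..1, partial₂ C x y ^ 2 := by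
    simp only [intervalIntegral.integral_of_le zero_le_one]
    exact (StronglyMeasurable.integral_prod_right (f := fun y x => partial₂ C x y ^ 2)
      ((hL.measurable_partial₂_uncurry.comp measurable_swap).pow_const 2).stronglyMeasurable
      ).measurable
  rw [intervalIntegral.integral_congr fun y _ => h2 y, intervalIntegral.integral_add, h1]
  · exact (isCopula_star h.swap h).continuous_diag.intervalIntegrable _ _
  · refine intervalIntegrable_of_abs_le hmeas (c := 1) (fun y => abs_integral_le fun t => ?_) _ _
    rw [abs_pow]
    exact pow_le_one₀ (abs_nonneg _) (h.abs_partial₂_le _ _)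

lemma SepLipschitz.sobolevNorm_le (h : SepLipschitz K C) :
    sobolevNorm C ≤ Real.sqrt ((K : ℝ) ^ 2 + (K : ℝ) ^ 2) := by
  refine Real.sqrt_le_sqrt ?_
  refine (le_abs_self _).trans (abs_integral_le fun y => abs_integral_le fun x => ?_)
  rw [abs_of_nonneg (by positivity), ← sq_abs (partial₁ C x y), ← sq_abs (partial₂ C x y)]
  exact add_le_add (pow_le_pow_left₀ (abs_nonneg _) (h.abs_partial₁_le _ _) 2)
    (pow_le_pow_left₀ (abs_nonneg _) (h.abs_partial₂_le _ _) 2)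

/-! ### Invertible copulas -/

lemma IsCopula.diag_le (h : IsCopula C) (x : ℝ) : extend C x x ≤ clamp x := by
  have := h.mono_left (clamp x) (show clamp x ≤ 1 from (clamp x).2.2)
  simpa [h.left_one, extend] using this

/-- Every copula is at most $M$; monotonicity in each variable gives $C(x,y)\ge C(m,m)=m$ for
$m=\min(x,y)$. -/
lemma IsCopula.eq_minCopula (h : IsCopula C) (hd : ∀ x : unitInterval, C x x = x) :
    C = minCopula := by
  ext x y
  refine le_antisymm (le_min ?_ ?_) ?_
  · simpa [h.right_one] using h.swap.mono_left x (show y ≤ 1 from y.2.2)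
  · simpa [h.left_one] using h.mono_left y (show x ≤ 1 from x.2.2)
  · rcases le_total x y with hxy | hxy
    · exact (min_le_left _ _).trans ((hd x).symm.le.trans (h.swap.mono_left x hxy))
    · exact (min_le_right _ _).trans ((hd y).symm.le.trans (h.mono_left y hxy))

/-- A left invertible copula is left inverted by its transpose, on the diagonal. -/
lemma IsCopula.diag_of_star_eq (hD : IsCopula D) (hU : IsCopula U) (h : star D U = minCopula)
    (y : ℝ) : extend (star (Function.swap U) U) y y = clamp y := by
  refine le_antisymm ((isCopula_star hU.swap hU).diag_le y) ?_
  rw [← integral_partial₁_sq]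
  have hi := hU.sepLipschitz.intervalIntegrable_partial₁_sq y
  have hi' : IntervalIntegrable (fun t => partial₂ D y t) volume 0 1 :=
    intervalIntegrable_of_abs_le (measurable_partial₂ y) (hD.abs_partial₂_le y) _ _
  have h1 : (clamp y : ℝ) = ∫ t in (0 : ℝ)..1, partial₂ D y t * partial₁ U t y := by
    have := congrFun (congrFun h (clamp y)) (clamp y)
    rw [minCopula, min_self, star] at this
    simpa only [partial₁_clamp, partial₂_clamp] using this.symm
  have h2 : ∫ t in (0 : ℝ)..1, partial₂ D y t = clamp y := by
    rw [hD.sepLipschitz.integral_partial₂, hD.extend_zero_right, hD.extend_one_right, sub_zero]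
  -- $2ab\le a^2+b^2\le a+b^2$, as $0\le a\le1$ for $a=\partial_2D$. Integrated, this reads $2y\le
  -- y+\int(\partial_1U)^2$.
  have h3 : ∫ t in (0 : ℝ)..1, 2 * (partial₂ D y t * partial₁ U t y) ≤
      ∫ t in (0 : ℝ)..1, (partial₂ D y t + partial₁ U t y ^ 2) := by
    refine intervalIntegral.integral_mono_on zero_le_one
      ((hD.sepLipschitz.intervalIntegrable_star hU.sepLipschitz y y 0 1).const_mul 2)
      (hi'.add hi) fun t _ => ?_
    nlinarith [sq_nonneg (partial₂ D y t - partial₁ U t y), hD.partial₂_nonneg y t,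
      hD.partial₂_le_one y t]
  rw [intervalIntegral.integral_const_mul, ← h1, intervalIntegral.integral_add hi' hi, h2] at h3
  linarith

lemma integral_clamp : ∫ y in (0 : ℝ)..1, (clamp y : ℝ) = 1 / 2 := by
  rw [integral_congr_Ioo (g := fun y => y) fun t ht => clamp_of_mem (Ioo_subset_Icc_self ht)]
  norm_num [integral_id]

lemma sobolevNorm_eq_one_of_mem_invCopulas (h : U ∈ invCopulas) : sobolevNorm U = 1 := by
  obtain ⟨hU, D, hD, h1, h2⟩ := h
  have h3 := hD.diag_of_star_eq hU h2
  have h4 : ∀ x : ℝ, extend (star U (Function.swap U)) x x = clamp x :=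
    hD.swap.diag_of_star_eq hU.swap (by rw [← swap_star, h1, swap_minCopula])
  rw [sobolevNorm, hU.integral_sobolev]
  simp only [h3, h4, integral_clamp]
  norm_num

lemma continuous_coe_clamp : Continuous fun x => (clamp x : ℝ) :=
  continuous_subtype_val.comp continuous_projIcc

/-- The diagonal is continuous and below the identity, whose integral is $1/2$; a gap at one point
would make the inequality of integrals strict. -/
lemma IsCopula.diag_of_integral_eq (h : IsCopula C)
    (hi : 1 / 2 ≤ ∫ x in (0 : ℝ)..1, extend C x x) : C = minCopula := by
  refine h.eq_minCopula fun x => ?_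
  by_contra hne
  refine absurd hi (not_le.2 ?_)
  rw [← integral_clamp]
  refine intervalIntegral.integral_lt_integral_of_continuousOn_of_le_of_exists_lt zero_lt_one
    h.continuous_diag.continuousOn continuous_coe_clamp.continuousOn (fun y _ => h.diag_le y)
    ⟨x, x.2, ?_⟩
  rw [extend_coe, clamp_coe]
  refine lt_of_le_of_ne ?_ hne
  simpa [extend_coe, clamp_coe] using h.diag_le x

lemma mem_invCopulas_of_sobolevNorm (hU : IsCopula U) (h : sobolevNorm U = 1) :
    U ∈ invCopulas := by
  rw [sobolevNorm, Real.sqrt_eq_one, hU.integral_sobolev] at h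
  have h1 := isCopula_star hU.swap hU
  have h2 := isCopula_star hU hU.swap
  have hle : ∀ {C}, IsCopula C → ∫ x in (0 : ℝ)..1, extend C x x ≤ 1 / 2 := fun {C} hC => by
    rw [← integral_clamp]
    exact intervalIntegral.integral_mono_on zero_le_one (hC.continuous_diag.intervalIntegrable _ _)
      (continuous_coe_clamp.intervalIntegrable _ _) fun x _ => hC.diag_le x
  exact ⟨hU, _, hU.swap, h2.diag_of_integral_eq (by linarith [hle h1]),
    h1.diag_of_integral_eq (by linarith [hle h2])⟩

lemma minCopula_mem_invCopulas : minCopula ∈ invCopulas :=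
  have h := minCopula_star isCopula_minCopula.mem_span
  ⟨isCopula_minCopula, _, isCopula_minCopula, h, h⟩

lemma star_mem_invCopulas (hU : U ∈ invCopulas) (hV : V ∈ invCopulas) :
    star U V ∈ invCopulas := by
  obtain ⟨hU, D, hD, h1, h2⟩ := hU
  obtain ⟨hV, E, hE, h3, h4⟩ := hV
  have hUV := isCopula_star hU hV
  have hED := isCopula_star hE hD
  refine ⟨hUV, _, hED, ?_, ?_⟩
  · rw [star_assoc hU.mem_span hV.mem_span hED.mem_span,
      ← star_assoc hV.mem_span hE.mem_span hD.mem_span, h3, minCopula_star hD.mem_span, h1]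
  · rw [star_assoc hE.mem_span hD.mem_span hUV.mem_span,
      ← star_assoc hD.mem_span hU.mem_span hV.mem_span, h2, minCopula_star hV.mem_span, h4]

lemma exists_inverse (hU : U ∈ invCopulas) :
    ∃ D ∈ invCopulas, star U D = minCopula ∧ star D U = minCopula := by
  obtain ⟨hU, D, hD, h1, h2⟩ := hU
  exact ⟨D, ⟨hD, U, hU, h2, h1⟩, h1, h2⟩

/-! ### Shuffling maps -/

lemma shuffle_mem_span (hU : U ∈ spanCopulas) (hV : V ∈ spanCopulas) (hA : A ∈ spanCopulas) :
    shuffle U V A ∈ spanCopulas :=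
  star_mem_span (star_mem_span hU hA) hV

lemma shuffle_add (hU : U ∈ spanCopulas) (hV : V ∈ spanCopulas) (hA : A ∈ spanCopulas)
    (hB : B ∈ spanCopulas) : shuffle U V (A + B) = shuffle U V A + shuffle U V B := by
  simp only [shuffle]
  rw [star_add hU hA hB, add_star (star_mem_span hU hA) (star_mem_span hU hB) hV]

lemma shuffle_smul (a : ℝ) : shuffle U V (a • A) = a • shuffle U V A := by
  simp only [shuffle]
  rw [star_smul, smul_star]

lemma shuffle_sub (hU : U ∈ spanCopulas) (hV : V ∈ spanCopulas) (hA : A ∈ spanCopulas)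
    (hB : B ∈ spanCopulas) : shuffle U V (A - B) = shuffle U V A - shuffle U V B := by
  rw [sub_eq_add_neg, ← neg_one_smul ℝ B, shuffle_add hU hV hA (Submodule.smul_mem _ _ hB),
    shuffle_smul, neg_one_smul, sub_eq_add_neg]

/-- The Lipschitz constants of all shuffles of an element of the span are bounded. -/
lemma exists_sepLipschitz_shuffle (hA : A ∈ spanCopulas) :
    ∃ K, ∀ U V, IsCopula U → IsCopula V → SepLipschitz K (shuffle U V A) := by
  induction hA using Submodule.span_induction with
  | mem C hC =>
    -- A shuffle of a copula is again a copula, so the constant 1 serves for all `U` and `V`.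
    exact ⟨1, fun U V hU hV => (isCopula_star (isCopula_star hU hC) hV).sepLipschitz⟩
  | zero =>
    refine ⟨0, fun U V _ _ => ?_⟩
    rw [shuffle, star_zero, zero_star]
    exact .zero
  | add C D hC hD h1 h2 =>
    obtain ⟨K, hK⟩ := h1
    obtain ⟨L, hL⟩ := h2
    refine ⟨K + L, fun U V hU hV => ?_⟩
    rw [shuffle_add hU.mem_span hV.mem_span hC hD]
    exact (hK U V hU hV).add (hL U V hU hV)
  | smul a C _ h =>
    obtain ⟨K, hK⟩ := h
    refine ⟨‖a‖₊ * K, fun U V hU hV => ?_⟩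
    rw [shuffle_smul]
    exact (hK U V hU hV).smul a

lemma shuffleNorms_nonempty (A : unitInterval → unitInterval → ℝ) : (shuffleNorms A).Nonempty :=
  ⟨_, _, minCopula_mem_invCopulas, _, minCopula_mem_invCopulas, rfl⟩

lemma bddAbove_shuffleNorms (hA : A ∈ spanCopulas) : BddAbove (shuffleNorms A) := by
  obtain ⟨K, hK⟩ := exists_sepLipschitz_shuffle hA
  refine ⟨Real.sqrt ((K : ℝ) ^ 2 + (K : ℝ) ^ 2), ?_⟩
  rintro _ ⟨U, hU, V, hV, rfl⟩
  exact (hK U V hU.1 hV.1).sobolevNorm_le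

/-- $W*(U*A)*V=(W*U)*A*V$, and $W*U$ is again invertible. -/
lemma shuffleNorms_star_left_subset (hA : A ∈ spanCopulas) (hU : U ∈ invCopulas) :
    shuffleNorms (star U A) ⊆ shuffleNorms A := by
  rintro _ ⟨W, hW, V, hV, rfl⟩
  refine ⟨_, star_mem_invCopulas hW hU, V, hV, ?_⟩
  rw [shuffle, shuffle, star_assoc hW.1.mem_span hU.1.mem_span hA]

lemma shuffleNorms_star_right_subset (hA : A ∈ spanCopulas) (hU : U ∈ invCopulas) :
    shuffleNorms (star A U) ⊆ shuffleNorms A := by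
  rintro _ ⟨W, hW, V, hV, rfl⟩
  have hW' := hW.1.mem_span
  refine ⟨W, hW, _, star_mem_invCopulas hU hV, ?_⟩
  rw [shuffle, shuffle, ← star_assoc hW' hA hU.1.mem_span,
    star_assoc (star_mem_span hW' hA) hU.1.mem_span hV.1.mem_span]

lemma shuffleNorms_star_left (hA : A ∈ spanCopulas) (hU : U ∈ invCopulas) :
    shuffleNorms (star U A) = shuffleNorms A := by
  refine (shuffleNorms_star_left_subset hA hU).antisymm ?_
  obtain ⟨D, hD, -, h⟩ := exists_inverse hU
  -- The same inclusion for the inverse `D` and the element $U*A$, since $D*(U*A)=A$.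
  have := shuffleNorms_star_left_subset (star_mem_span hU.1.mem_span hA) hD
  rwa [← star_assoc hD.1.mem_span hU.1.mem_span hA, h, minCopula_star hA] at this

lemma shuffleNorms_star_right (hA : A ∈ spanCopulas) (hU : U ∈ invCopulas) :
    shuffleNorms (star A U) = shuffleNorms A := by
  refine (shuffleNorms_star_right_subset hA hU).antisymm ?_
  obtain ⟨D, hD, h, -⟩ := exists_inverse hU
  have := shuffleNorms_star_right_subset (star_mem_span hA hU.1.mem_span) hD
  rwa [star_assoc hA hU.1.mem_span hD.1.mem_span, h, star_minCopula hA] at this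

lemma starNorm_star_left (hA : A ∈ spanCopulas) (hU : U ∈ invCopulas) :
    starNorm (star U A) = starNorm A := by
  rw [starNorm, shuffleNorms_star_left hA hU, starNorm]

lemma starNorm_star_right (hA : A ∈ spanCopulas) (hU : U ∈ invCopulas) :
    starNorm (star A U) = starNorm A := by
  rw [starNorm, shuffleNorms_star_right hA hU, starNorm]

lemma starNorm_shuffle (hU : U ∈ invCopulas) (hV : V ∈ invCopulas) (hA : A ∈ spanCopulas) :
    starNorm (shuffle U V A) = starNorm A := by
  rw [shuffle, starNorm_star_right (star_mem_span hU.1.mem_span hA) hV, starNorm_star_left hA hU]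

end Copula

end

theorem mainTheorem8 :
    -- invertible copulas are exactly the copulas of unit Sobolev norm
    (∀ U : unitInterval → unitInterval → ℝ,
      U ∈ Copula.invCopulas ↔ Copula.IsCopula U ∧ Copula.sobolevNorm U = 1) ∧
    -- the supremum defining the `*`-norm is a genuine, finite one
    (∀ A ∈ Copula.spanCopulas,
      (Copula.shuffleNorms A).Nonempty ∧ BddAbove (Copula.shuffleNorms A)) ∧
    -- invariance under multiplication by invertible copulas
    (∀ A ∈ Copula.spanCopulas, ∀ U ∈ Copula.invCopulas,
      Copula.star U A ∈ Copula.spanCopulas ∧ Copula.star A U ∈ Copula.spanCopulas ∧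
      Copula.starNorm (Copula.star U A) = Copula.starNorm A ∧
      Copula.starNorm A = Copula.starNorm (Copula.star A U)) ∧
    -- shuffling maps are isometries of the span for the `*`-norm
    (∀ U ∈ Copula.invCopulas, ∀ V ∈ Copula.invCopulas,
      (∀ A ∈ Copula.spanCopulas, Copula.shuffle U V A ∈ Copula.spanCopulas) ∧
      (∀ A ∈ Copula.spanCopulas, ∀ B ∈ Copula.spanCopulas,
        Copula.starNorm (Copula.shuffle U V A - Copula.shuffle U V B) =
          Copula.starNorm (A - B))) := by
  refine ⟨fun U => ⟨fun h => ⟨h.1, Copula.sobolevNorm_eq_one_of_mem_invCopulas h⟩,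
      fun h => Copula.mem_invCopulas_of_sobolevNorm h.1 h.2⟩,
    fun A hA => ⟨Copula.shuffleNorms_nonempty A, Copula.bddAbove_shuffleNorms hA⟩,
    fun A hA U hU => ⟨Copula.star_mem_span hU.1.mem_span hA, Copula.star_mem_span hA hU.1.mem_span,
      Copula.starNorm_star_left hA hU, (Copula.starNorm_star_right hA hU).symm⟩,
    fun U hU V hV => ⟨fun A hA => Copula.shuffle_mem_span hU.1.mem_span hV.1.mem_span hA,
      fun A hA B hB => ?_⟩⟩
  -- Linearity reduces the isometry to invariance of the norm at `A - B`.
  rw [← Copula.shuffle_sub hU.1.mem_span hV.1.mem_span hA hB,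
    Copula.starNorm_shuffle hU hV (sub_mem hA hB)]
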